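/- Let $M$ be a matroid on a finite set $E$ with $|E|=n$, rank function $\mathrm{rk}$ and rank $k=\mathrm{rk}(E)$. Its Tutte polynomial is $$T_M(x,y)=\sum_{A\subseteq E}(x-1)^{k-\mathrm{rk}(A)}(y-1)^{|A|-\mathrm{rk}(A)}\in\mathbb Z[x,y].$$ A subset $F\subseteq E$ is *stressed* if both the restriction $M|_F$ and the contraction $M/F$ are uniform matroids; its *cusp* is $\mathrm{cusp}(F)=\{S\subseteq E: |S|=k,\ |S\cap F|\ge \mathrm{rk}(F)+1\}$. If $F$ is stressed, the *relaxation* $\mathrm{Rel}(M,F)$ is the matroid on $E$ whose bases are the bases of $M$ together with the members of $\mathrm{cusp}(F)$. For $0\le r\le k$, $i>r$ and $0\le j<k-r$ put $$\alpha^{i,j}_{r,k}(x,y)=\begin{cases}(x-1)^{k-i-j}\bigl(1-((x-1)(y-1))^{i-r}\bigr)&\text{if } i+j\le k,\\ (y-1)^{i+j-k}\bigl(1-((x-1)(y-1))^{k-r-j}\bigr)&\text{if } i+j>k.\end{cases}$$ (1) Let $F$ be a stressed subset of $M$ with non-empty cusp, and let $r=\mathrm{rk}(F)$, $h=|F|$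 and $\widetilde M=\mathrm{Rel}(M,F)$. Then $$T_{\widetilde M}(x,y)=T_M(x,y)+\sum_{i=r+1}^{h}\sum_{j=0}^{k-r-1}\binom{h}{i}\binom{n-h}{j}\,\alpha^{i,j}_{r,k}(x,y),$$ and $T_{\widetilde M}(x,y)-T_M(x,y)$ is a multiple of $x+y-xy$ in $\mathbb Z[x,y]$. (2) Suppose that $M$ is an *elementary split matroid*, that is, either a direct sum of two uniform matroids, or a connected split matroid. Here a *connected split matroid* is a connected matroid (one that is not a direct sum of two non-empty matroids) in which every split flacet is stressed, where a *split flacet* is a flat $F$ such that $M|_F$ and $M/F$ are connected, $0<\mathrm{rk}(F)<|F|$, and $E\setminus F$ contains an element that is not a coloop of $M$. Let $\lambda_{r,h}$ be the number of stressed subsets of $M$ with non-empty cusp that have rank $r$ and size $h$. Then $$T_M(x,y)=T_{U_{k,n}}(x,y)-\sum_{r=0}^{k}\sum_{h=0}^{n}\lambda_{r,h}\sum_{i=r+1}^{h}\sum_{j=0}^{k-r-1}\binom{h}{i}\binom{n-h}{j}\,\alpha^{i,j}_{r,k}(x,y),$$ where $U_{k,n}$ is the uniform matroid of rank $k$ on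 $n$ elements. -/

import Mathlib

namespace Matroid

variable {α : Type*}

/-- The rank of a set `A`, as a natural number (for matroids with finite ground set). -/
noncomputable def rk (M : Matroid α) (A : Set α) : ℕ := (M.eRk A).toNat

/-- The uniform matroid `U_{k,n}` on `n` elements: for `k ≤ n` its bases are the `k`-element
subsets. (The minimum only makes the definition total in `k` and `n`.) -/
noncomputable def uniform (k n : ℕ) : Matroid (Fin n) :=
  Matroid.ofIsBaseOfFinite (E := Set.univ) Set.finite_univ (fun B => B.ncard = min k n)
    (by
      obtain ⟨B, -, hB⟩ := Set.exists_subset_card_eq (s := (Set.univ : Set (Fin n)))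
        (n := min k n) (by simp [Set.ncard_univ])
      exact ⟨B, hB⟩)
    (by
      intro X Y hX hY a ha
      obtain ⟨b, hbY, hbX⟩ : ∃ b ∈ Y, b ∉ X := by
        by_contra! h
        have : Y = X := Set.eq_of_subset_of_ncard_le h (by omega) (Set.toFinite _)
        exact ha.2 (this ▸ ha.1)
      refine ⟨b, ⟨hbY, hbX⟩, ?_⟩
      exact (Set.ncard_exchange hbX ha.1).trans hX)
    (fun _ _ => Set.subset_univ _)

instance (k n : ℕ) : (uniform k n).Finite := ⟨Set.toFinite _⟩

/-- `M` is uniform: for some `k`, its bases are exactly the `k`-element subsets of the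
ground set. -/
def IsUniform (M : Matroid α) : Prop :=
  ∃ k : ℕ, ∀ B : Set α, M.IsBase B ↔ B ⊆ M.E ∧ B.encard = k

/-- A matroid is connected if it is not a direct sum of two non-empty matroids. -/
def IsConnected (M : Matroid α) : Prop :=
  ¬ ∃ (M₁ M₂ : Matroid α) (h : Disjoint M₁.E M₂.E),
    M₁.E.Nonempty ∧ M₂.E.Nonempty ∧ M = M₁.disjointSum M₂ h

/-- The cusp of `A`: the sets `S` of cardinality `rk(M)` with `|S ∩ A| ≥ rk(A) + 1`. -/
def cusp (M : Matroid α) (A : Set α) : Set (Set α) :=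
  {S | S ⊆ M.E ∧ S.ncard = M.rk M.E ∧ M.rk A + 1 ≤ (S ∩ A).ncard}

/-- `A` is stressed if both the restriction to `A` and the contraction by `A` are uniform. -/
def IsStressed (M : Matroid α) (A : Set α) : Prop :=
  A ⊆ M.E ∧ (M ↾ A).IsUniform ∧ (M ／ A).IsUniform

/-- A flacet is a flat `F` such that `M|F` and `M/F` are connected; it is a split flacet if
moreover `0 < rk(F) < |F|` and some element outside `F` is not a coloop. -/
def IsSplitFlacet (M : Matroid α) (F : Set α) : Prop :=
  M.IsFlat F ∧ (M ↾ F).IsConnected ∧ (M ／ F).IsConnected ∧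
    0 < M.rk F ∧ M.rk F < F.ncard ∧ ∃ e ∈ M.E \ F, ¬ M.IsColoop e

/-- A connected split matroid is a connected matroid all of whose split flacets are stressed. -/
def IsConnectedSplit (M : Matroid α) : Prop :=
  M.IsConnected ∧ ∀ F, M.IsSplitFlacet F → M.IsStressed F

/-- An elementary split matroid is a connected split matroid or a direct sum of two
uniform matroids. -/
def IsElementarySplit (M : Matroid α) : Prop :=
  M.IsConnectedSplit ∨
    ∃ (M₁ M₂ : Matroid α) (h : Disjoint M₁.E M₂.E),
      M₁.IsUniform ∧ M₂.IsUniform ∧ M = M₁.disjointSum M₂ h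

section Relaxation

variable {M : Matroid α} {A B S : Set α}

lemma IsBase.ncard_eq_rk_ground (hB : M.IsBase B) : B.ncard = M.rk M.E := by
  rw [rk, eRk_ground, ← hB.encard_eq_eRank, Set.ncard]

variable [M.Finite]

lemma IsBase.ncard_inter_le_rk (hB : M.IsBase B) (A : Set α) : (B ∩ A).ncard ≤ M.rk A := by
  have h := (hB.indep.inter_right A).encard_le_eRk_of_subset Set.inter_subset_right
  exact ENat.toNat_le_toNat h ((M.isRkFinite_set A).eRk_lt_top.ne)

lemma IsStressed.isBase_of_ncard_inter (hA : M.IsStressed A) (hSE : S ⊆ M.E)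
    (hS : S.ncard = M.rk M.E) (hSA : (S ∩ A).ncard = M.rk A) : M.IsBase S := by
  obtain ⟨hAE, ⟨c, hc⟩, ⟨d, hd⟩⟩ := hA
  have hfin : S.Finite := M.set_finite S hSE
  obtain ⟨J, hJ⟩ := M.exists_isBasis A
  have hJc := ((hc J).1 hJ.restrict_isBase).2
  have hrc : M.rk A = c := by rw [rk, ← hJ.encard_eq_eRk, hJc, ENat.toNat_natCast]
  have hI : M.IsBasis (S ∩ A) A := by
    refine (isBase_restrict_iff hAE).1 ((hc _).2 ⟨Set.inter_subset_right, ?_⟩)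
    rw [← (hfin.inter_of_left A).cast_ncard_eq, hSA, hrc]
  obtain ⟨B, hB, hIB⟩ := hI.indep.exists_isBase_superset
  have hBfin : B.Finite := M.set_finite B hB.subset_ground
  have hBA : B ∩ A = S ∩ A :=
    (hI.eq_of_subset_indep (hB.indep.inter_right A) (Set.subset_inter hIB Set.inter_subset_right)
      Set.inter_subset_right).symm
  have hBk := hB.ncard_eq_rk_ground
  have hBd : (B \ A).ncard + (B ∩ A).ncard = B.ncard := by
    rw [add_comm]; exact Set.ncard_inter_add_ncard_sdiff_eq_ncard B A hBfin
  have hSd : (S \ A).ncard + (S ∩ A).ncard = S.ncard := by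
    rw [add_comm]; exact Set.ncard_inter_add_ncard_sdiff_eq_ncard S A hfin
  -- `B \ A` is independent in the contraction, and so is contained in a base of it
  have hBind : (M ／ A).Indep (B \ A) := by
    rw [hI.contract_indep_iff]
    refine ⟨hB.indep.subset ?_, Set.disjoint_sdiff_right⟩
    exact Set.union_subset Set.sdiff_subset hIB
  obtain ⟨B', hB', hBB'⟩ := hBind.exists_isBase_superset
  have hB'd := ((hd B').1 hB').2
  have hB'fin : B'.Finite := Set.finite_of_encard_eq_coe hB'd
  have hB'ind := hI.contract_indep_iff.1 hB'.indep
  have hB'n : B'.ncard = d := by rw [Set.ncard, hB'd, ENat.toNat_natCast]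
  have hle1 : (B \ A).ncard ≤ d := hB'n ▸ Set.ncard_le_ncard hBB' hB'fin
  have hle2 : (B' ∪ (S ∩ A)).ncard ≤ M.rk M.E := by
    obtain ⟨B'', hB'', hs⟩ := hB'ind.1.exists_isBase_superset
    rw [← hB''.ncard_eq_rk_ground]
    exact Set.ncard_le_ncard hs (M.set_finite B'' hB''.subset_ground)
  rw [Set.ncard_union_eq (hB'ind.2.symm.mono_right Set.inter_subset_right) hB'fin
    (hfin.inter_of_left A)] at hle2
  have hSbase : (M ／ A).IsBase (S \ A) := by
    refine (hd _).2 ⟨Set.sdiff_subset_sdiff_left hSE, ?_⟩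
    rw [← (hfin.sdiff).cast_ncard_eq]
    rw [hBA] at hBd
    congr 1
    omega
  have hSind := (hI.contract_indep_iff.1 hSbase.indep).1
  rw [Set.sdiff_union_inter] at hSind
  obtain ⟨B'', hB'', hs⟩ := hSind.exists_isBase_superset
  have : S = B'' := Set.eq_of_subset_of_ncard_le hs (by rw [hB''.ncard_eq_rk_ground, hS])
    (M.set_finite B'' hB''.subset_ground)
  exact this ▸ hB''

lemma IsStressed.isBase_or_mem_cusp (hA : M.IsStressed A) (hSE : S ⊆ M.E)
    (hS : S.ncard = M.rk M.E) (hSA : M.rk A ≤ (S ∩ A).ncard) : M.IsBase S ∨ S ∈ M.cusp A := by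
  rcases hSA.eq_or_lt with h | h
  · exact Or.inl (hA.isBase_of_ncard_inter hSE hS h.symm)
  · exact Or.inr ⟨hSE, hS, h⟩

/-- The bases of `M` together with the cusp of a stressed subset satisfy the basis-exchange
property. -/
lemma IsStressed.exchangeProperty (hA : M.IsStressed A) :
    ExchangeProperty (fun B => M.IsBase B ∨ B ∈ M.cusp A) := by
  have hP : ∀ B, (M.IsBase B ∨ B ∈ M.cusp A) → B ⊆ M.E ∧ B.ncard = M.rk M.E := by
    rintro B (hB | hB)
    · exact ⟨hB.subset_ground, hB.ncard_eq_rk_ground⟩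
    · exact ⟨hB.1, hB.2.1⟩
  -- an exchange that keeps at least `rk(A)` elements in `A` is always allowed
  have key : ∀ X Y a b, (M.IsBase X ∨ X ∈ M.cusp A) → (M.IsBase Y ∨ Y ∈ M.cusp A) → a ∈ X →
      b ∈ Y → b ∉ X → M.rk A ≤ ((insert b (X \ {a})) ∩ A).ncard →
      (M.IsBase (insert b (X \ {a})) ∨ insert b (X \ {a}) ∈ M.cusp A) := by
    intro X Y a b hX hY ha hb hbX h
    refine hA.isBase_or_mem_cusp ?_ ?_ h
    · exact Set.insert_subset ((hP Y hY).1 hb) (Set.sdiff_subset.trans (hP X hX).1)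
    · rw [Set.ncard_exchange hbX ha, (hP X hX).2]
  intro X Y hX hY a ha
  have hXfin : X.Finite := M.set_finite X (hP X hX).1
  have hYfin : Y.Finite := M.set_finite Y (hP Y hY).1
  have hXk := (hP X hX).2
  have hYk := (hP Y hY).2
  by_cases hXc : X ∈ M.cusp A
  · obtain ⟨b, hbY, hbX⟩ : ∃ b ∈ Y, b ∉ X := by
      by_contra! h
      have : Y = X := Set.eq_of_subset_of_ncard_le h (by omega) hXfin
      exact ha.2 (this ▸ ha.1)
    refine ⟨b, ⟨hbY, hbX⟩, key X Y a b hX hY ha.1 hbY hbX ?_⟩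
    have h1 : ((X ∩ A) \ {a}).ncard ≤ ((insert b (X \ {a})) ∩ A).ncard := by
      refine Set.ncard_le_ncard ?_ ((hXfin.sdiff.insert b).inter_of_left A)
      rintro x ⟨⟨hx, hxA⟩, hxa⟩
      exact ⟨Or.inr ⟨hx, hxa⟩, hxA⟩
    have h2 := Set.pred_ncard_le_ncard_sdiff_singleton (X ∩ A) a
    have h3 := hXc.2.2
    omega
  have hXB : M.IsBase X := hX.resolve_right hXc
  by_cases hYB : M.IsBase Y
  · obtain ⟨b, hb, hB⟩ := hXB.exchange hYB ha
    exact ⟨b, hb, Or.inl hB⟩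
  have hYc : Y ∈ M.cusp A := hY.resolve_left hYB
  have hXr := hXB.ncard_inter_le_rk A
  have hYr := hYc.2.2
  by_cases hXeq : (X ∩ A).ncard = M.rk A
  · obtain ⟨b, hb, hbX⟩ := Set.exists_mem_notMem_of_ncard_lt_ncard
      (show (X ∩ A).ncard < (Y ∩ A).ncard by omega) (hXfin.inter_of_left A)
    have hbX' : b ∉ X := fun h => hbX ⟨h, hb.2⟩
    refine ⟨b, ⟨hb.1, hbX'⟩, key X Y a b hX hY ha.1 hb.1 hbX' ?_⟩
    rw [← hXeq]
    have h1 : (insert b ((X ∩ A) \ {a})).ncard ≤ ((insert b (X \ {a})) ∩ A).ncard := by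
      refine Set.ncard_le_ncard ?_ ((hXfin.sdiff.insert b).inter_of_left A)
      rintro x (rfl | ⟨⟨hx, hxA⟩, hxa⟩)
      · exact ⟨Or.inl rfl, hb.2⟩
      · exact ⟨Or.inr ⟨hx, hxa⟩, hxA⟩
    rw [Set.ncard_insert_of_notMem (fun h => hbX h.1)
      ((hXfin.inter_of_left A).sdiff)] at h1
    have h2 := Set.pred_ncard_le_ncard_sdiff_singleton (X ∩ A) a
    omega
  -- the remaining case `|X ∩ A| < rk(A)`: exchange with an auxiliary base
  obtain ⟨P, hPs, hPn⟩ := Set.exists_subset_card_eq (s := Y ∩ A) (n := M.rk A) (by omega)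
  have hXd : (X ∩ A).ncard + (X \ A).ncard = X.ncard :=
    Set.ncard_inter_add_ncard_sdiff_eq_ncard X A hXfin
  have hXa := Set.pred_ncard_le_ncard_sdiff_singleton (X \ A) a
  have hrk : M.rk A ≤ M.rk M.E := by
    have := Set.ncard_le_ncard (Set.inter_subset_left : Y ∩ A ⊆ Y) hYfin
    omega
  obtain ⟨Q, hQs, hQn⟩ := Set.exists_subset_card_eq (s := (X \ A) \ {a})
    (n := M.rk M.E - M.rk A) (by omega)
  have hPfin : P.Finite := (hYfin.inter_of_left A).subset hPs
  have hQfin : Q.Finite := (hXfin.sdiff.sdiff).subset hQs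
  have hPQ : Disjoint P Q :=
    Set.disjoint_left.2 fun x hxP hxQ => (hQs hxQ).1.2 (hPs hxP).2
  have hB : M.IsBase (P ∪ Q) := by
    refine hA.isBase_of_ncard_inter ?_ ?_ ?_
    · exact Set.union_subset (fun x hx => (hP Y hY).1 (hPs hx).1)
        (fun x hx => (hP X hX).1 (hQs hx).1.1)
    · rw [Set.ncard_union_eq hPQ hPfin hQfin]
      omega
    · rw [← hPn]
      congr 1
      ext x
      constructor
      · rintro ⟨hx | hx, hxA⟩
        · exact hx
        · exact absurd hxA (hQs hx).1.2
      · exact fun hx => ⟨Or.inl hx, (hPs hx).2⟩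
  have haPQ : a ∉ P ∪ Q := by
    rintro (h | h)
    · exact ha.2 (hPs h).1
    · exact (hQs h).2 rfl
  obtain ⟨b, hb, hbB⟩ := hXB.exchange hB ⟨ha.1, haPQ⟩
  refine ⟨b, ⟨?_, hb.2⟩, Or.inl hbB⟩
  rcases hb.1 with h | h
  · exact (hPs h).1
  · exact absurd (hQs h).1.1 hb.2

end Relaxation

/-- The relaxation `Rel(M, A)` of a stressed subset `A`: the matroid on the same ground set whose
bases are the bases of `M` together with the members of the cusp of `A`. -/
def relax (M : Matroid α) [M.Finite] (A : Set α) (hA : M.IsStressed A) : Matroid α :=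
  Matroid.ofIsBaseOfFinite (E := M.E) M.ground_finite
    (fun B => M.IsBase B ∨ B ∈ M.cusp A)
    (M.exists_isBase.imp fun _ hB => Or.inl hB)
    hA.exchangeProperty
    (by
      rintro B (hB | hB)
      · exact hB.subset_ground
      · exact hB.1)

instance (M : Matroid α) [M.Finite] (A : Set α) (hA : M.IsStressed A) :
    (M.relax A hA).Finite := ⟨M.ground_finite⟩

open MvPolynomial in
/-- The Tutte polynomial `T_M(x, y) = ∑_{A ⊆ E} (x-1)^(rk E - rk A) (y-1)^(|A| - rk A)`, an element
of `ℤ[x, y]` with `x = X 0` and `y = X 1`. -/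
noncomputable def tutte (M : Matroid α) [M.Finite] : MvPolynomial (Fin 2) ℤ :=
  ∑ A ∈ M.ground_finite.toFinset.powerset,
    (X 0 - 1) ^ (M.rk M.E - M.rk (A : Set α)) * (X 1 - 1) ^ (A.card - M.rk (A : Set α))

open MvPolynomial in
/-- The polynomials `α_{r,k}^{i,j}(x, y)`, used for `i > r` and `j < k - r` only. -/
noncomputable def tutteAlpha (r k i j : ℕ) : MvPolynomial (Fin 2) ℤ :=
  if i + j ≤ k then
    (X 0 - 1) ^ (k - i - j) * (1 - ((X 0 - 1) * (X 1 - 1)) ^ (i - r))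
  else
    (X 1 - 1) ^ (i + j - k) * (1 - ((X 0 - 1) * (X 1 - 1)) ^ (k - r - j))

/-- `λ_{r,h}`: the number of stressed subsets with non-empty cusp of rank `r` and size `h`. -/
noncomputable def numStressed (M : Matroid α) (r h : ℕ) : ℕ :=
  {F : Set α | M.IsStressed F ∧ (M.cusp F).Nonempty ∧ M.rk F = r ∧ F.ncard = h}.ncard

end Matroid

/-! Let `k` be the rank of `M`, and write `r` for the rank of a stressed set `F`. Relaxing `F`
changes the rank of exactly the sets `A` with |A ∩ F| > r and |A \ F| < k - r (`IsRaisedBy`): their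
rank goes from r + |A \ F| up to min(|A|, k), the rank in a uniform matroid. With i = |A ∩ F| and j
= |A \ F|, the change in the term of `A` in the Tutte polynomial is precisely `tutteAlpha r k i j`.
Counting sets with given i and j produces the binomial coefficients, and each alpha is divisible by
1 - (x-1)(y-1) = x + y - xy.

For an elementary split matroid no chain of relaxations is needed: `M` is compared with the uniform
matroid term by term. Every set with rk A < min(|A|, k) is raised by exactly one stressed set.
Uniqueness (`IsStressed.eq_of_isRaisedBy`): A ∩ F consists of the elements whose deletion preserves
rk A, and its closure is `F`. Existence (`IsElementarySplit.exists_isRaisedBy`): for a sum of two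
uniform matroids one of the two ground sets works; for a connected split matroid the closure of any
circuit inside `A` works, since a maximal proper connected flat above it is a split flacet, hence
stressed, and uniformity then forces it to equal the closure. -/

namespace Matroid

/-! ### Natural-number ranks: submodularity, contraction, uniform matroids. -/

section RankFunction

variable {α : Type*} {M : Matroid α} {A B F S X Y : Set α}

lemma cast_rk [M.RankFinite] (A : Set α) : (M.rk A : ℕ∞) = M.eRk A :=
  ENat.natCast_toNat (M.isRkFinite_set A).eRk_lt_top.ne

lemma rk_eq_of_eRk_eq {β : Type*} {N : Matroid β} {T : Set β} (h : M.eRk A = N.eRk T) :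
    M.rk A = N.rk T := by
  rw [rk, rk, h]

lemma rk_mono [M.RankFinite] (h : X ⊆ Y) : M.rk X ≤ M.rk Y :=
  ENat.toNat_le_toNat (M.eRk_mono h) (M.isRkFinite_set Y).eRk_lt_top.ne

lemma rk_inter_add_rk_union_le [M.RankFinite] (X Y : Set α) :
    M.rk (X ∩ Y) + M.rk (X ∪ Y) ≤ M.rk X + M.rk Y := by
  have h := M.eRk_inter_add_eRk_union_le X Y
  rw [← cast_rk, ← cast_rk, ← cast_rk, ← cast_rk] at h
  exact_mod_cast h

lemma rk_union_le [M.RankFinite] (X Y : Set α) : M.rk (X ∪ Y) ≤ M.rk X + M.rk Y := by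
  have := M.rk_inter_add_rk_union_le X Y
  omega

lemma rk_closure_eq (M : Matroid α) (X : Set α) : M.rk (M.closure X) = M.rk X := by
  simp [rk]

lemma Indep.rk_eq_ncard (h : M.Indep A) : M.rk A = A.ncard := by
  rw [rk, h.eRk_eq_encard, Set.ncard]

lemma rk_le_ncard [M.RankFinite] (hA : A.Finite) : M.rk A ≤ A.ncard := by
  have h := M.eRk_le_encard A
  rw [← cast_rk, ← hA.cast_ncard_eq] at h
  exact_mod_cast h

lemma indep_iff_rk_eq_ncard [M.RankFinite] (hA : A.Finite) : M.Indep A ↔ M.rk A = A.ncard := by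
  rw [indep_iff_eRk_eq_encard, ← cast_rk, ← hA.cast_ncard_eq, Nat.cast_inj]

lemma IsCircuit.rk_add_one_eq [M.Finite] (h : M.IsCircuit A) : M.rk A + 1 = A.ncard := by
  have h' := h.eRk_add_one_eq
  rw [← cast_rk, ← (M.set_finite A h.subset_ground).cast_ncard_eq] at h'
  exact_mod_cast h'

lemma exists_isBase_ncard_inter_eq [M.Finite] (hA : A ⊆ M.E) :
    ∃ B, M.IsBase B ∧ (B ∩ A).ncard = M.rk A := by
  obtain ⟨I, hI⟩ := M.exists_isBasis A
  obtain ⟨B, hB, hIB⟩ := hI.exists_isBase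
  refine ⟨B, hB, ?_⟩
  rw [← hIB, rk, hI.eRk_eq_encard, Set.ncard]

lemma rk_restrict (h : X ⊆ A) : (M ↾ A).rk X = M.rk X :=
  rk_eq_of_eRk_eq (M.restrict_eRk_eq h)

lemma rk_contract_add [M.Finite] (hF : F ⊆ M.E) (hX : X ⊆ M.E \ F) :
    (M ／ F).rk X + M.rk F = M.rk (X ∪ F) := by
  obtain ⟨J, hJ⟩ := (M ／ F).exists_isBasis X hX
  obtain ⟨I, hI⟩ := M.exists_isBasis F
  have hJi := hI.contract_indep_iff.1 hJ.indep
  have hd : Disjoint J I := (hJi.2.mono_left hI.subset).symm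
  -- A basis of `X` in the contraction together with a basis of `F` is a basis of the union; the
  -- rank identity counts its elements.
  have hbasis : M.IsBasis (J ∪ I) (X ∪ F) := by
    refine hJi.1.isBasis_of_forall_insert (Set.union_subset_union hJ.subset hI.subset) ?_
    rintro e ⟨he | he, heJI⟩
    · have h1 := hJ.insert_dep ⟨he, fun h => heJI (Or.inl h)⟩
      have h2 := mt hI.contract_indep_iff.2 h1.not_indep
      rw [← not_indep_iff (Set.insert_subset (hX he).1 hJi.1.subset_ground)]
      intro h3
      refine h2 ⟨by rwa [Set.insert_union], ?_⟩
      exact Set.disjoint_left.2 fun x hxF hx => by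
        rcases hx with rfl | hx
        · exact (hX he).2 hxF
        · exact (hX (hJ.subset hx)).2 hxF
    · exact (hI.insert_dep ⟨he, fun h => heJI (Or.inr h)⟩).superset
        (Set.insert_subset_insert Set.subset_union_right)
        (Set.insert_subset (hF he) hJi.1.subset_ground)
  have hfin := M.set_finite _ hJi.1.subset_ground
  rw [rk, rk, rk, hJ.eRk_eq_encard, hI.eRk_eq_encard, hbasis.eRk_eq_encard]
  exact (Set.ncard_union_eq hd (hfin.subset Set.subset_union_left)
    (hfin.subset Set.subset_union_right)).symm

lemma rk_contract_ground_add [M.Finite] (hF : F ⊆ M.E) :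
    (M ／ F).rk (M ／ F).E + M.rk F = M.rk M.E := by
  rw [contract_ground, rk_contract_add hF subset_rfl, Set.sdiff_union_of_subset hF]

lemma isBase_iff_ncard [M.Finite] (hB : B ⊆ M.E) :
    M.IsBase B ↔ M.rk B = M.rk M.E ∧ B.ncard = M.rk M.E := by
  constructor
  · intro h
    exact ⟨by rw [h.indep.rk_eq_ncard, h.ncard_eq_rk_ground], h.ncard_eq_rk_ground⟩
  · rintro ⟨h1, h2⟩
    have hi : M.Indep B := (indep_iff_rk_eq_ncard (M.set_finite B)).2 (by omega)
    refine hi.isBase_of_eRk_ge (M.set_finite B) ?_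
    rw [← eRk_ground, ← cast_rk, ← cast_rk, h1]

lemma IsUniform.rk_eq [M.Finite] (hM : M.IsUniform) (hA : A ⊆ M.E) :
    M.rk A = min A.ncard (M.rk M.E) := by
  obtain ⟨c, hc⟩ := hM
  obtain ⟨B₀, hB₀⟩ := M.exists_isBase
  have hcE : M.rk M.E = c := by
    rw [← hB₀.ncard_eq_rk_ground, Set.ncard, ((hc _).1 hB₀).2, ENat.toNat_natCast]
  have hbase : ∀ B ⊆ M.E, B.ncard = c → M.IsBase B := fun B hB h =>
    (hc B).2 ⟨hB, by rw [← (M.set_finite B hB).cast_ncard_eq, h]⟩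
  have hcn : c ≤ M.E.ncard := by
    rw [← hcE]; exact rk_le_ncard M.ground_finite
  rw [hcE]
  rcases le_total A.ncard c with h | h
  · obtain ⟨B, hAB, hBE, hBc⟩ := Set.exists_subsuperset_card_eq hA h hcn
    rw [((hbase B hBE hBc).indep.subset hAB).rk_eq_ncard, min_eq_left h]
  · obtain ⟨B, hBA, hBc⟩ := Set.exists_subset_card_eq h
    rw [min_eq_right h]
    refine le_antisymm (hcE ▸ rk_mono hA) ?_
    rw [← hBc, ← (hbase B (hBA.trans hA) hBc).indep.rk_eq_ncard]
    exact rk_mono hBA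

lemma isUniform_of_rk_eq [M.Finite] (h : ∀ A ⊆ M.E, M.rk A = min A.ncard (M.rk M.E)) :
    M.IsUniform := by
  refine ⟨M.rk M.E, fun B => ⟨fun hB => ⟨hB.subset_ground, ?_⟩, fun ⟨hBE, hB⟩ => ?_⟩⟩
  · rw [← hB.ncard_eq_rk_ground, (M.set_finite B hB.subset_ground).cast_ncard_eq]
  · have hB' : B.ncard = M.rk M.E := by rw [Set.ncard, hB, ENat.toNat_natCast]
    exact (isBase_iff_ncard hBE).2 ⟨by rw [h B hBE, hB', min_self], hB'⟩

lemma uniform_rk (k n : ℕ) (A : Set (Fin n)) : (uniform k n).rk A = min A.ncard (min k n) := by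
  have hbase : ∀ B, (uniform k n).IsBase B ↔ B.ncard = min k n := fun B => Iff.rfl
  have hU : (uniform k n).IsUniform := by
    refine ⟨min k n, fun B => ?_⟩
    rw [hbase, ← (Set.toFinite B).cast_ncard_eq, Nat.cast_inj]
    exact ⟨fun h => ⟨Set.subset_univ _, h⟩, fun h => h.2⟩
  obtain ⟨B, hB⟩ := (uniform k n).exists_isBase
  rw [hU.rk_eq (Set.subset_univ A), ← hB.ncard_eq_rk_ground, (hbase B).1 hB]

end RankFunction

/-! ### Ranks around a stressed set, and the rank function of the relaxation. -/

section Stressed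

variable {α : Type*} {M : Matroid α} [M.Finite] {A B F G S X Y : Set α}

/-- Expresses both uniformity conditions through the rank function of `M` alone, so that later
arguments avoid minors and reduce to arithmetic. -/
lemma isStressed_iff_rk : M.IsStressed F ↔ F ⊆ M.E ∧
    (∀ X ⊆ F, M.rk X = min X.ncard (M.rk F)) ∧
    ∀ X ⊆ M.E \ F, M.rk (X ∪ F) = M.rk F + min X.ncard (M.rk M.E - M.rk F) := by
  constructor
  · rintro ⟨hF, h1, h2⟩
    have : (M ↾ F).Finite := ⟨M.set_finite F hF⟩
    refine ⟨hF, fun X hX => ?_, fun X hX => ?_⟩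
    · rw [← rk_restrict hX, h1.rk_eq hX, restrict_ground_eq, rk_restrict subset_rfl]
    · have h3 := rk_contract_ground_add hF
      rw [← rk_contract_add hF hX, h2.rk_eq hX, ← h3, Nat.add_sub_cancel, add_comm]
  · rintro ⟨hF, h1, h2⟩
    have : (M ↾ F).Finite := ⟨M.set_finite F hF⟩
    refine ⟨hF, isUniform_of_rk_eq fun X hX => ?_, isUniform_of_rk_eq fun X hX => ?_⟩
    · rw [restrict_ground_eq, rk_restrict (A := F) hX, rk_restrict subset_rfl, h1 X hX]
    · have h3 := rk_contract_ground_add hF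
      have h4 := rk_contract_add hF hX
      rw [h2 X hX] at h4
      omega

/-- By uniformity of the restriction A ∩ F has the rank of `F`, so by submodularity `A` has the rank
of A ∪ F, which the uniform contraction determines. -/
lemma IsStressed.rk_eq_of_rk_le_ncard_inter (hF : M.IsStressed F) (hA : A ⊆ M.E)
    (h : M.rk F ≤ (A ∩ F).ncard) :
    M.rk A = M.rk F + min (A \ F).ncard (M.rk M.E - M.rk F) := by
  obtain ⟨hFE, h1, h2⟩ := isStressed_iff_rk.1 hF
  rw [← h2 (A \ F) (Set.sdiff_subset_sdiff_left hA), Set.sdiff_union_self]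
  have h3 := h1 (A ∩ F) Set.inter_subset_right
  rw [min_eq_right h] at h3
  have h4 := M.rk_inter_add_rk_union_le A F
  have h5 := M.rk_mono (Set.subset_union_left : A ⊆ A ∪ F)
  omega

/-- The sets whose rank grows under relaxation of the stressed subset `F`. -/
def IsRaisedBy (M : Matroid α) (F A : Set α) : Prop :=
  M.rk F < (A ∩ F).ncard ∧ (A \ F).ncard < M.rk M.E - M.rk F

lemma IsStressed.rk_eq_of_isRaisedBy (hF : M.IsStressed F) (hA : A ⊆ M.E)
    (h : M.IsRaisedBy F A) : M.rk A = M.rk F + (A \ F).ncard := by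
  rw [hF.rk_eq_of_rk_le_ncard_inter hA h.1.le, min_eq_left h.2.le]

lemma ncard_inter_add_ncard_sdiff (hA : A ⊆ M.E) (F : Set α) :
    (A ∩ F).ncard + (A \ F).ncard = A.ncard :=
  Set.ncard_inter_add_ncard_sdiff_eq_ncard A F (M.set_finite A hA)

lemma IsStressed.rk_lt_of_isRaisedBy (hF : M.IsStressed F) (hA : A ⊆ M.E)
    (h : M.IsRaisedBy F A) : M.rk A < min A.ncard (M.rk M.E) := by
  have h1 := hF.rk_eq_of_isRaisedBy hA h
  have h2 := ncard_inter_add_ncard_sdiff hA F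
  obtain ⟨h3, h4⟩ := h
  omega

/-- Since |A ∩ F| exceeds rk F, deleting an element of `F` still leaves a spanning part of `F`;
deleting one outside `F` lowers |A \ F|, and with it the rank. The criterion on the right does not
mention `F`, so A ∩ F is determined by `A`. -/
lemma IsStressed.mem_iff_of_isRaisedBy (hF : M.IsStressed F) (hA : A ⊆ M.E)
    (h : M.IsRaisedBy F A) {e : α} (he : e ∈ A) : e ∈ F ↔ M.rk (A \ {e}) = M.rk A := by
  have hAe : A \ {e} ⊆ M.E := Set.sdiff_subset.trans hA
  have hrk := hF.rk_eq_of_isRaisedBy hA h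
  obtain ⟨h1, h2⟩ := h
  by_cases heF : e ∈ F
  · have h3 : (A \ {e}) ∩ F = (A ∩ F) \ {e} := by ext; simp; tauto
    have h4 : (A \ {e}) \ F = A \ F := by
      ext x; simp only [Set.mem_sdiff, Set.mem_singleton_iff]
      exact ⟨fun h => ⟨h.1.1, h.2⟩, fun h => ⟨⟨h.1, fun hx => h.2 (hx ▸ heF)⟩, h.2⟩⟩
    have h5 := Set.pred_ncard_le_ncard_sdiff_singleton (A ∩ F) e
    rw [hF.rk_eq_of_rk_le_ncard_inter hAe (by rw [h3]; omega), h4, hrk, min_eq_left h2.le]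
    simp [heF]
  · have h3 : (A \ {e}) ∩ F = A ∩ F := by
      ext x; simp only [Set.mem_sdiff, Set.mem_singleton_iff, Set.mem_inter_iff]
      exact ⟨fun h => ⟨h.1.1, h.2⟩, fun h => ⟨⟨h.1, fun hx => heF (hx ▸ h.2)⟩, h.2⟩⟩
    have h4 : (A \ {e}) \ F = (A \ F) \ {e} := by ext; simp; tauto
    have h5 := Set.ncard_sdiff_singleton_add_one (show e ∈ A \ F from ⟨he, heF⟩)
      ((M.set_finite A hA).sdiff)
    rw [hF.rk_eq_of_rk_le_ncard_inter hAe (by rw [h3]; omega), h4, hrk, min_eq_left (by omega)]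
    simp only [heF, false_iff]
    omega

/-- A ∩ F has full rank in `F`, and `F` is a flat because the contraction is uniform of positive
rank and so has no loops. -/
lemma IsStressed.closure_inter_of_isRaisedBy (hF : M.IsStressed F)
    (h : M.IsRaisedBy F A) : M.closure (A ∩ F) = F := by
  obtain ⟨hFE, h1, h2⟩ := isStressed_iff_rk.1 hF
  obtain ⟨h3, h4⟩ := h
  have h5 := h1 (A ∩ F) Set.inter_subset_right
  rw [min_eq_right h3.le] at h5
  rw [(M.isRkFinite_set (A ∩ F)).closure_eq_closure_of_subset_of_eRk_ge_eRk
    Set.inter_subset_right (by rw [← cast_rk, ← cast_rk, h5])]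
  refine (M.subset_closure F hFE).antisymm' fun e he => ?_
  by_contra heF
  have h6 := h2 {e} (by simpa using ⟨M.closure_subset_ground F he, heF⟩)
  have h7 : M.rk ({e} ∪ F) ≤ M.rk F := by
    rw [← M.rk_closure_eq F]
    exact rk_mono (Set.union_subset (by simpa using he) (M.subset_closure F hFE))
  rw [Set.ncard_singleton] at h6
  omega

lemma IsStressed.eq_of_isRaisedBy (hF : M.IsStressed F) (hG : M.IsStressed G) (hA : A ⊆ M.E)
    (h : M.IsRaisedBy F A) (h' : M.IsRaisedBy G A) : F = G := by
  rw [← hF.closure_inter_of_isRaisedBy h, ← hG.closure_inter_of_isRaisedBy h']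
  congr 1
  ext e
  simp only [Set.mem_inter_iff, and_congr_right_iff]
  intro he
  rw [hF.mem_iff_of_isRaisedBy hA h he, hG.mem_iff_of_isRaisedBy hA h' he]

/-- Ensures that a set `F` raising some `A` is among those counted by `numStressed`. -/
lemma IsRaisedBy.cusp_nonempty (hA : A ⊆ M.E) (h : M.IsRaisedBy F A) : (M.cusp F).Nonempty := by
  obtain ⟨h1, h2⟩ := h
  obtain ⟨X, hX, hXn⟩ := Set.exists_subset_card_eq (show M.rk F + 1 ≤ (A ∩ F).ncard from h1)
  have hXE : X ⊆ M.E := hX.trans (Set.inter_subset_left.trans hA)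
  obtain ⟨S, hXS, hSE, hSn⟩ := Set.exists_subsuperset_card_eq hXE
    (show X.ncard ≤ M.rk M.E by omega) (rk_le_ncard M.ground_finite)
  refine ⟨S, hSE, hSn, ?_⟩
  rw [← hXn]
  exact Set.ncard_le_ncard (Set.subset_inter hXS (hX.trans Set.inter_subset_right))
    ((M.set_finite S hSE).inter_of_left F)

@[simp] lemma relax_ground (hF : M.IsStressed F) : (M.relax F hF).E = M.E := rfl

lemma relax_isBase_iff (hF : M.IsStressed F) :
    (M.relax F hF).IsBase B ↔ M.IsBase B ∨ B ∈ M.cusp F := Iff.rfl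

lemma relax_rk_ground (hF : M.IsStressed F) : (M.relax F hF).rk M.E = M.rk M.E := by
  obtain ⟨B, hB⟩ := M.exists_isBase
  have h : (M.relax F hF).IsBase B := (relax_isBase_iff hF).2 (Or.inl hB)
  rw [← hB.ncard_eq_rk_ground, h.ncard_eq_rk_ground, relax_ground]

lemma relax_rk_of_isRaisedBy (hF : M.IsStressed F) (hA : A ⊆ M.E) (h : M.IsRaisedBy F A) :
    (M.relax F hF).rk A = min A.ncard (M.rk M.E) := by
  obtain ⟨h1, h2⟩ := h
  have hAfin := M.set_finite A hA
  have hAn := ncard_inter_add_ncard_sdiff hA F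
  apply le_antisymm
  · refine le_min (rk_le_ncard hAfin) ?_
    rw [← relax_rk_ground hF]
    exact rk_mono hA
  have key : ∀ S ⊆ M.E, S.ncard = M.rk M.E → M.rk F < (S ∩ F).ncard →
      (S ∩ A).ncard ≤ (M.relax F hF).rk A := fun S hS hSn hSF =>
    IsBase.ncard_inter_le_rk ((relax_isBase_iff hF).2 (Or.inr ⟨hS, hSn, hSF⟩)) A
  rcases le_total A.ncard (M.rk M.E) with h | h
  · obtain ⟨S, hAS, hSE, hSn⟩ := Set.exists_subsuperset_card_eq hA h
      (rk_le_ncard M.ground_finite)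
    have h3 := key S hSE hSn (h1.trans_le (Set.ncard_le_ncard
      (Set.inter_subset_inter_left F hAS) ((M.set_finite S hSE).inter_of_left F)))
    rw [Set.inter_eq_right.2 hAS] at h3
    omega
  -- Keeping all of A \ F inside `S` leaves k - |A \ F| > rk F elements of `S` in `F`, which puts
  -- `S` in the cusp.
  · obtain ⟨S, hAS, hSA, hSn⟩ := Set.exists_subsuperset_card_eq
      (Set.sdiff_subset : A \ F ⊆ A) (by omega) h
    have hSF : S \ F = A \ F := (Set.sdiff_subset_sdiff_left hSA).antisymm
      fun x hx => ⟨hAS hx, hx.2⟩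
    have h4 := ncard_inter_add_ncard_sdiff (hSA.trans hA) F
    rw [hSF] at h4
    have h3 := key S (hSA.trans hA) hSn (by omega)
    rw [Set.inter_eq_left.2 hSA] at h3
    omega

lemma relax_rk_of_not_isRaisedBy (hF : M.IsStressed F) (hA : A ⊆ M.E)
    (h : ¬ M.IsRaisedBy F A) : (M.relax F hF).rk A = M.rk A := by
  have hAfin := M.set_finite A hA
  apply le_antisymm
  · obtain ⟨B, hB, hBA⟩ := exists_isBase_ncard_inter_eq (M := M.relax F hF) hA
    rw [← hBA]
    rcases (relax_isBase_iff hF).1 hB with hB | ⟨hBE, hBn, hBF⟩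
    · exact hB.ncard_inter_le_rk A
    -- If |A ∩ F| ≥ rk F, not being raised means equality or |A \ F| ≥ k - rk F; either way |B ∩ A|
    -- is at most the known rank of `A`.
    by_cases hAF : M.rk F ≤ (A ∩ F).ncard
    · rw [hF.rk_eq_of_rk_le_ncard_inter hA hAF]
      have h1 := ncard_inter_add_ncard_sdiff (Set.inter_subset_right.trans hA : B ∩ A ⊆ M.E) F
      have h2 : (B ∩ A).ncard ≤ B.ncard :=
        Set.ncard_le_ncard Set.inter_subset_left (M.set_finite B hBE)
      have h3 : ((B ∩ A) ∩ F).ncard ≤ (A ∩ F).ncard := Set.ncard_le_ncard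
        (Set.inter_subset_inter_left F Set.inter_subset_right) (hAfin.inter_of_left F)
      have h4 : ((B ∩ A) \ F).ncard ≤ (A \ F).ncard := Set.ncard_le_ncard
        (Set.sdiff_subset_sdiff_left Set.inter_subset_right) hAfin.sdiff
      have h5 : ¬ (M.rk F < (A ∩ F).ncard) ∨ ¬ ((A \ F).ncard < M.rk M.E - M.rk F) := by
        rw [← not_and_or]; exact h
      have h6 := ncard_inter_add_ncard_sdiff hBE F
      have h7 : ((B ∩ A) \ F).ncard ≤ (B \ F).ncard := Set.ncard_le_ncard
        (Set.sdiff_subset_sdiff_left Set.inter_subset_left) (M.set_finite B hBE).sdiff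
      omega
    · push Not at hAF
      obtain ⟨hFE, h1, h2⟩ := isStressed_iff_rk.1 hF
      have hBfin := M.set_finite B hBE
      have h6 := ncard_inter_add_ncard_sdiff hBE F
      have h7 : M.rk M.E - M.rk F ≤ (M.E \ F).ncard := by
        have h8 := h2 (M.E \ F) subset_rfl
        rw [Set.sdiff_union_of_subset hFE] at h8
        omega
      have h8 : ((B ∩ A) ∩ F).ncard ≤ (A ∩ F).ncard := Set.ncard_le_ncard
        (Set.inter_subset_inter_left F Set.inter_subset_right) (hAfin.inter_of_left F)
      have h9 : M.rk F ≤ M.rk M.E := rk_mono hFE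
      -- The cusp member `B` is traded for a base P ∪ Q of `M` that still contains B ∩ A: `P`
      -- shrinks B ∩ F to rk F elements and `Q` enlarges B \ F to k - rk F.
      obtain ⟨P, hP, hPF, hPn⟩ := Set.exists_subsuperset_card_eq
        (show (B ∩ A) ∩ F ⊆ B ∩ F from Set.inter_subset_inter_left F Set.inter_subset_left)
        (show ((B ∩ A) ∩ F).ncard ≤ M.rk F by omega) (by omega)
      obtain ⟨Q, hQ, hQF, hQn⟩ := Set.exists_subsuperset_card_eq
        (Set.sdiff_subset_sdiff_left hBE : B \ F ⊆ M.E \ F)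
        (show (B \ F).ncard ≤ M.rk M.E - M.rk F by omega) h7
      have hPE : P ⊆ M.E := hPF.trans (Set.inter_subset_left.trans hBE)
      have hQE : Q ⊆ M.E := hQF.trans Set.sdiff_subset
      have hd : Disjoint P Q := Set.disjoint_left.2 fun x hx hx' => (hQF hx').2 (hPF hx).2
      have hPQ : M.IsBase (P ∪ Q) := by
        refine hF.isBase_of_ncard_inter (Set.union_subset hPE hQE) ?_ ?_
        · rw [Set.ncard_union_eq hd (M.set_finite P hPE) (M.set_finite Q hQE)]
          omega
        · rw [← hPn]
          congr 1
          ext x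
          exact ⟨fun hx => hx.1.resolve_right fun hxQ => (hQF hxQ).2 hx.2,
            fun hx => ⟨Or.inl hx, (hPF hx).2⟩⟩
      refine le_trans (Set.ncard_le_ncard ?_ (hAfin.inter_of_right _))
        (hPQ.ncard_inter_le_rk A)
      intro x hx
      refine ⟨?_, hx.2⟩
      by_cases hxF : x ∈ F
      · exact Or.inl (hP ⟨hx, hxF⟩)
      · exact Or.inr (hQ ⟨hx.1, hxF⟩)
  · obtain ⟨B, hB, hBA⟩ := exists_isBase_ncard_inter_eq hA
    rw [← hBA]
    exact IsBase.ncard_inter_le_rk ((relax_isBase_iff hF).2 (Or.inl hB)) A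

end Stressed

end Matroid
namespace Matroid

/-! ### Connectedness through ranks, and existence of a raising stressed set. -/

section Connected

variable {α : Type*} {M : Matroid α} {A C F G W X Y : Set α}

lemma disjointSum_eRk {M₁ M₂ : Matroid α} (h : Disjoint M₁.E M₂.E) (hX : X ⊆ M₁.E ∪ M₂.E) :
    (M₁.disjointSum M₂ h).eRk X = M₁.eRk (X ∩ M₁.E) + M₂.eRk (X ∩ M₂.E) := by
  obtain ⟨I, hI⟩ := (M₁.disjointSum M₂ h).exists_isBasis X (by simpa using hX)
  obtain ⟨h1, h2, h3, -⟩ := disjointSum_isBasis_iff.1 hI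
  rw [hI.eRk_eq_encard, h1.eRk_eq_encard, h2.eRk_eq_encard,
    ← Set.encard_union_eq (h.mono Set.inter_subset_right Set.inter_subset_right),
    ← Set.inter_union_distrib_left, Set.inter_eq_left.2 (h3.trans hX)]

/-- A set is connected in `M` if no proper non-empty subset and its complement have ranks
adding up to the rank of the set. -/
def IsConnectedSet (M : Matroid α) (G : Set α) : Prop :=
  ∀ X ⊆ G, M.rk X + M.rk (G \ X) = M.rk G → X = ∅ ∨ X = G

variable [M.Finite]

/-- Bases of `X` and of its complement together span and have only rk E elements, so their union is
independent; hence so is every union of independent sets from the two sides. -/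
lemma eq_disjointSum_of_rk_add (hX : X ⊆ M.E) (h : M.rk X + M.rk (M.E \ X) = M.rk M.E) :
    ∃ h : Disjoint (M ↾ X).E (M ↾ (M.E \ X)).E,
      M = (M ↾ X).disjointSum (M ↾ (M.E \ X)) h := by
  have hdis : Disjoint (M ↾ X).E (M ↾ (M.E \ X)).E := by
    rw [restrict_ground_eq, restrict_ground_eq]
    exact Set.disjoint_sdiff_right
  refine ⟨hdis, ext_indep ?_ fun I hI => ?_⟩
  · rw [disjointSum_ground_eq, restrict_ground_eq, restrict_ground_eq, Set.union_sdiff_cancel hX]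
  rw [disjointSum_indep_iff, restrict_ground_eq, restrict_ground_eq, Set.union_sdiff_cancel hX,
    restrict_indep_iff, restrict_indep_iff, and_iff_left Set.inter_subset_right,
    and_iff_left Set.inter_subset_right]
  refine ⟨fun h => ⟨h.inter_right _, h.inter_right _, hI⟩, fun ⟨h1, h2, _⟩ => ?_⟩
  obtain ⟨J₁, hJ₁, hIJ₁⟩ := h1.subset_isBasis_of_subset Set.inter_subset_right hX
  obtain ⟨J₂, hJ₂, hIJ₂⟩ := h2.subset_isBasis_of_subset Set.inter_subset_right Set.sdiff_subset
  have hd : Disjoint J₁ J₂ :=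
    Set.disjoint_sdiff_right.mono hJ₁.subset hJ₂.subset
  have hf₁ := M.set_finite J₁ hJ₁.indep.subset_ground
  have hf₂ := M.set_finite J₂ hJ₂.indep.subset_ground
  have hJE : J₁ ∪ J₂ ⊆ M.E := Set.union_subset hJ₁.indep.subset_ground hJ₂.indep.subset_ground
  have hr₁ : M.rk X = J₁.ncard := by rw [rk, hJ₁.eRk_eq_encard, Set.ncard]
  have hr₂ : M.rk (M.E \ X) = J₂.ncard := by rw [rk, hJ₂.eRk_eq_encard, Set.ncard]
  have hcl : M.closure (J₁ ∪ J₂) = M.closure M.E := by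
    rw [← Set.union_sdiff_cancel hX, ← M.closure_union_closure_left_eq,
      ← M.closure_union_closure_right_eq, hJ₁.closure_eq_closure, hJ₂.closure_eq_closure,
      M.closure_union_closure_left_eq, M.closure_union_closure_right_eq]
  have hJ : M.Indep (J₁ ∪ J₂) := by
    rw [indep_iff_rk_eq_ncard (hf₁.union hf₂), Set.ncard_union_eq hd hf₁ hf₂, ← hr₁, ← hr₂, h,
      ← rk_closure_eq, hcl, rk_closure_eq]
  refine hJ.subset fun x hx => ?_
  by_cases hxX : x ∈ X
  · exact Or.inl (hIJ₁ ⟨hx, hxX⟩)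
  · exact Or.inr (hIJ₂ ⟨hx, hI hx, hxX⟩)

lemma isConnected_iff_rk : M.IsConnected ↔ M.IsConnectedSet M.E := by
  constructor
  · intro hM X hX h
    by_contra! hne
    obtain ⟨hd, heq⟩ := eq_disjointSum_of_rk_add hX h
    refine hM ⟨_, _, hd, ?_, ?_, heq⟩
    · exact hne.1
    · exact Set.sdiff_nonempty.2 fun h' => hne.2 (hX.antisymm h')
  · rintro hM ⟨M₁, M₂, h, h1, h2, rfl⟩
    have hi : M₂.E ∩ M₁.E = ∅ := h.symm.inter_eq
    have hi' : M₁.E ∩ M₂.E = ∅ := h.inter_eq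
    have hs : (M₁.E ∪ M₂.E) \ M₁.E = M₂.E := by
      rw [Set.union_sdiff_left, h.symm.sdiff_eq_left]
    have key : (M₁.disjointSum M₂ h).eRk M₁.E + (M₁.disjointSum M₂ h).eRk M₂.E =
        (M₁.disjointSum M₂ h).eRk (M₁.E ∪ M₂.E) := by
      rw [disjointSum_eRk h Set.subset_union_left, disjointSum_eRk h Set.subset_union_right,
        disjointSum_eRk h subset_rfl]
      simp [hi, hi', Set.union_inter_cancel_left, Set.union_inter_cancel_right]
    rw [← cast_rk, ← cast_rk, ← cast_rk] at key
    rcases hM M₁.E (by simp) (by rw [disjointSum_ground_eq, hs]; exact_mod_cast key) with h3 | h3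
    · exact h1.ne_empty h3
    · rw [disjointSum_ground_eq] at h3
      obtain ⟨x, hx⟩ := h2
      exact h.le_bot ⟨h3 ▸ Or.inr hx, hx⟩

lemma restrict_isConnected_iff (hG : G ⊆ M.E) : (M ↾ G).IsConnected ↔ M.IsConnectedSet G := by
  have : (M ↾ G).Finite := ⟨M.set_finite G hG⟩
  rw [isConnected_iff_rk]
  refine forall₂_congr fun X hX => ?_
  rw [restrict_ground_eq, rk_restrict (A := G) hX, rk_restrict Set.sdiff_subset,
    rk_restrict subset_rfl]

lemma IsConnected.rk_singleton (hM : M.IsConnected) (hE : M.E.Nontrivial) {e : α} (he : e ∈ M.E) :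
    M.rk {e} = 1 := by
  have h1 : M.rk {e} ≤ 1 := by simpa using M.rk_le_ncard (Set.finite_singleton e)
  have h2 := M.rk_union_le {e} (M.E \ {e})
  have h3 : M.rk (M.E \ {e}) ≤ M.rk M.E := rk_mono Set.sdiff_subset
  rw [Set.union_sdiff_cancel (by simpa using he)] at h2
  by_contra h4
  rcases isConnected_iff_rk.1 hM {e} (by simpa using he) (by omega) with h | h
  · simp at h
  · rw [← h] at hE
    simp at hE

lemma IsConnected.not_isColoop (hM : M.IsConnected) (hE : M.E.Nontrivial) {e : α} :
    ¬ M.IsColoop e := by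
  intro h
  have he := h.mem_ground
  have h1 : M.rk {e} ≤ 1 := by simpa using M.rk_le_ncard (Set.finite_singleton e)
  have h2 := M.rk_union_le {e} (M.E \ {e})
  rw [Set.union_sdiff_cancel (by simpa using he)] at h2
  rw [isColoop_iff_sdiff_not_spanning, spanning_iff_eRk_le, ← eRk_ground, ← cast_rk, ← cast_rk,
    Nat.cast_le] at h
  rcases isConnected_iff_rk.1 hM {e} (by simpa using he) (by omega) with h | h
  · simp at h
  · rw [← h] at hE
    simp at hE

lemma IsFlat.rk_lt_of_ssubset (hG : M.IsFlat G) (hGX : G ⊂ X) (hX : X ⊆ M.E) :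
    M.rk G < M.rk X := by
  obtain ⟨e, heX, heG⟩ := Set.exists_of_ssubset hGX
  have h1 := eRk_insert_eq_add_one (M := M) (X := G) (e := e) ⟨hX heX, by rwa [hG.closure]⟩
  rw [← cast_rk, ← cast_rk] at h1
  have h2 : M.rk (insert e G) = M.rk G + 1 := by exact_mod_cast h1
  have h3 : M.rk (insert e G) ≤ M.rk X := rk_mono (Set.insert_subset heX hGX.subset)
  omega

lemma isFlat_of_rk_lt (hG : G ⊆ M.E) (h : ∀ e ∈ M.E \ G, M.rk G < M.rk (insert e G)) :
    M.IsFlat G := by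
  refine isFlat_iff_closure_eq.2 ((M.subset_closure G hG).antisymm' fun e he => ?_)
  by_contra heG
  refine (h e ⟨M.closure_subset_ground G he, heG⟩).not_ge ?_
  rw [← M.rk_closure_eq G]
  exact rk_mono (Set.insert_subset he (M.subset_closure G hG))

/-- If a separation cuts the circuit, both pieces are independent and the ranks add up to at least
|C| = rk C + 1. If not, the side missing `C` has rank 0, and is empty without loops. -/
lemma IsCircuit.isConnectedSet_closure (hC : M.IsCircuit C)
    (hloop : ∀ e ∈ M.E, M.rk {e} = 1) : M.IsConnectedSet (M.closure C) := by
  have hCcl := M.subset_closure C hC.subset_ground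
  have hCfin := M.set_finite C hC.subset_ground
  have hzero : ∀ Y ⊆ M.closure C, M.rk Y = 0 → Y = ∅ := by
    intro Y hY h0
    by_contra hne
    obtain ⟨e, he⟩ := Set.nonempty_iff_ne_empty.2 hne
    have h1 := hloop e (M.closure_subset_ground C (hY he))
    have h2 : M.rk {e} ≤ M.rk Y := rk_mono (by simpa using he)
    omega
  have hsub : ∀ Y ⊆ M.closure C, M.rk Y + M.rk (M.closure C \ Y) = M.rk (M.closure C) →
      C ⊆ Y → Y = M.closure C := by
    intro Y hY h hCY
    have h1 : M.rk C ≤ M.rk Y := rk_mono hCY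
    rw [rk_closure_eq] at h
    have h2 := hzero _ Set.sdiff_subset (show M.rk (M.closure C \ Y) = 0 by omega)
    exact hY.antisymm (Set.sdiff_eq_empty.1 h2)
  intro X hX h
  by_cases hCX : C ⊆ X
  · exact Or.inr (hsub X hX h hCX)
  by_cases hCX' : Disjoint C X
  · left
    have h1 := hsub (M.closure C \ X) Set.sdiff_subset
      (by rw [Set.sdiff_sdiff_cancel_left hX, add_comm, h]) (Set.subset_sdiff.2 ⟨hCcl, hCX'⟩)
    rw [← Set.sdiff_sdiff_cancel_left hX, h1, Set.sdiff_self]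
  have hi1 : M.Indep (C ∩ X) := hC.ssubset_indep
    (Set.inter_subset_left.ssubset_of_ne fun h => hCX (Set.inter_eq_left.1 h))
  have hi2 : M.Indep (C \ X) := hC.ssubset_indep
    (Set.sdiff_subset.ssubset_of_ne fun h => hCX' (sdiff_eq_left.1 h))
  have h1 : M.rk (C ∩ X) ≤ M.rk X := rk_mono Set.inter_subset_right
  have h2 : M.rk (C \ X) ≤ M.rk (M.closure C \ X) := rk_mono (Set.sdiff_subset_sdiff_left hCcl)
  rw [hi1.rk_eq_ncard] at h1
  rw [hi2.rk_eq_ncard] at h2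
  have h3 := ncard_inter_add_ncard_sdiff hC.subset_ground X
  have h4 := hC.rk_add_one_eq
  rw [rk_closure_eq] at h
  omega

/-- A connected set stays connected when a separator of the contraction by it is added. -/
lemma IsConnectedSet.union (hM : M.IsConnected) (hG : M.IsConnectedSet G) (hGne : G.Nonempty)
    {W' : Set α} (hE : G ∪ W ∪ W' = M.E) (hGW' : Disjoint G W')
    (hWW' : Disjoint W W') (h : M.rk (G ∪ W) + M.rk (G ∪ W') = M.rk M.E + M.rk G) :
    M.IsConnectedSet (G ∪ W) := by
  -- When `G` lies on one side of a separation, submodularity against G ∪ W' makes the other side a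
  -- separator of all of `M`.
  have key : ∀ X ⊆ G ∪ W, M.rk X + M.rk ((G ∪ W) \ X) = M.rk (G ∪ W) → G ⊆ X → X = G ∪ W := by
    intro X hX hsum hGX
    have hXE : (G ∪ W) ⊆ M.E := hE ▸ Set.subset_union_left
    have hcompl : M.E \ ((G ∪ W) \ X) = X ∪ W' := by
      rw [← hE]
      ext x
      have h1 : x ∈ G → x ∉ W' := fun h h' => Set.disjoint_left.1 hGW' h h'
      have h2 : x ∈ W → x ∉ W' := fun h h' => Set.disjoint_left.1 hWW' h h'
      have h3 := @hX x
      simp only [Set.mem_sdiff, Set.mem_union] at *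
      tauto
    have hinter : X ∩ (G ∪ W') = G := by
      ext x
      have h2 : x ∈ W → x ∉ W' := fun h h' => Set.disjoint_left.1 hWW' h h'
      have h3 := @hX x
      have h4 := @hGX x
      simp only [Set.mem_inter_iff, Set.mem_union] at *
      tauto
    have hunion : X ∪ (G ∪ W') = X ∪ W' := by
      rw [← Set.union_assoc, Set.union_eq_left.2 hGX]
    have h1 := M.rk_inter_add_rk_union_le X (G ∪ W')
    rw [hinter, hunion] at h1
    have h2 := M.rk_union_le ((G ∪ W) \ X) (M.E \ ((G ∪ W) \ X))
    rw [Set.union_sdiff_cancel (Set.sdiff_subset.trans hXE), hcompl] at h2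
    rcases isConnected_iff_rk.1 hM ((G ∪ W) \ X) (Set.sdiff_subset.trans hXE)
      (by rw [hcompl]; omega) with h3 | h3
    · exact hX.antisymm (Set.sdiff_eq_empty.1 h3)
    · obtain ⟨x, hx⟩ := hGne
      exact absurd (hGX hx) (h3.ge (hXE (Or.inl hx))).2
  intro X hX hsum
  -- Any separation of G ∪ W induces one of `G`, so the connected set `G` lies entirely on one side.
  have hres : M.rk (G ∩ X) + M.rk (G \ X) = M.rk G := by
    have h1 := M.rk_inter_add_rk_union_le G X
    have h2 := M.rk_inter_add_rk_union_le (G ∪ X) ((G ∪ W) \ X)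
    have h3 : (G ∪ X) ∩ ((G ∪ W) \ X) = G \ X := by
      ext x
      simp only [Set.mem_inter_iff, Set.mem_union, Set.mem_sdiff]
      tauto
    have h4 : M.rk (G ∪ W) ≤ M.rk (G ∪ X ∪ (G ∪ W) \ X) := rk_mono fun x hx => by
      simp only [Set.mem_union, Set.mem_sdiff] at *
      tauto
    have h5 := M.rk_union_le (G ∩ X) (G \ X)
    rw [Set.inter_union_sdiff] at h5
    rw [h3] at h2
    omega
  rcases hG (G ∩ X) Set.inter_subset_left (by rwa [Set.sdiff_self_inter]) with h1 | h1
  · left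
    have h2 := key ((G ∪ W) \ X) Set.sdiff_subset
      (by rw [Set.sdiff_sdiff_cancel_left hX, add_comm, hsum])
      (Set.subset_sdiff.2 ⟨Set.subset_union_left, Set.disjoint_iff_inter_eq_empty.2 h1⟩)
    rw [← Set.sdiff_sdiff_cancel_left hX, h2, Set.sdiff_self]
  · exact Or.inr (key X hX hsum (Set.inter_eq_left.1 h1))

/-- The closure need not visibly be a flacet, so a maximal proper connected flat `G` above it is
used. Maximality makes the contraction by `G` connected, hence `G` is stressed. -/
lemma IsConnectedSplit.isStressed_closure (hM : M.IsConnectedSplit) (hE : M.E.Nontrivial)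
    (hC : M.IsCircuit C) (hCrk : M.rk C < M.rk M.E) : M.IsStressed (M.closure C) := by
  obtain ⟨hconn, hsplit⟩ := hM
  have hloop : ∀ e ∈ M.E, M.rk {e} = 1 := fun e he => hconn.rk_singleton hE he
  have hCcl := M.subset_closure C hC.subset_ground
  let s : Set (Set α) := {G | M.IsFlat G ∧ G ≠ M.E ∧ M.IsConnectedSet G}
  have hs : s.Finite := M.ground_finite.powerset.subset fun G hG => hG.1.subset_ground
  have hmem : M.closure C ∈ s := ⟨M.isFlat_closure C,
    fun h => by rw [← M.rk_closure_eq, h] at hCrk; omega, hC.isConnectedSet_closure hloop⟩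
  obtain ⟨G, hCG, ⟨hGf, hGE, hGc⟩, hmax⟩ := hs.exists_le_maximal hmem
  have hCG : M.closure C ⊆ G := hCG
  have hGsub := hGf.subset_ground
  have hGne : G.Nonempty := hC.nonempty.mono (hCcl.trans hCG)
  have hGcon : (M ／ G).IsConnected := by
    rw [isConnected_iff_rk]
    by_contra hcon
    unfold IsConnectedSet at hcon
    push Not at hcon
    obtain ⟨W, hW, hsum, hW0, hW1⟩ := hcon
    rw [contract_ground] at hW hsum hW1
    have hdW' : Disjoint G ((M.E \ G) \ W) := Set.disjoint_sdiff_right.mono_right Set.sdiff_subset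
    have hunion : G ∪ W ∪ ((M.E \ G) \ W) = M.E := by
      rw [Set.union_assoc, Set.union_sdiff_cancel hW, Set.union_sdiff_cancel hGsub]
    set W' := (M.E \ G) \ W
    have hW'sub : W' ⊆ M.E \ G := Set.sdiff_subset
    have h1 := rk_contract_add hGsub hW
    have h2 := rk_contract_add hGsub hW'sub
    have h3 := rk_contract_add hGsub (subset_refl (M.E \ G))
    rw [Set.sdiff_union_of_subset hGsub] at h3
    rw [Set.union_comm] at h1 h2
    have hrk : M.rk (G ∪ W) + M.rk (G ∪ W') = M.rk M.E + M.rk G := by omega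
    have hGWE : G ∪ W ⊆ M.E := hunion ▸ Set.subset_union_left
    have hGW'E : G ∪ W' ⊆ M.E := Set.union_subset hGsub (hW'sub.trans Set.sdiff_subset)
    -- A separator `W` of the contraction would give a strictly larger proper connected flat,
    -- against maximality of `G`.
    have hmemW : G ∪ W ∈ s := by
      refine ⟨isFlat_of_rk_lt hGWE fun e he => ?_, fun h => ?_,
        hGc.union hconn hGne hunion hdW' Set.disjoint_sdiff_right hrk⟩
      · have heW' : e ∈ W' := ⟨⟨he.1, fun h => he.2 (Or.inl h)⟩, fun h => he.2 (Or.inr h)⟩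
        have h4 := M.rk_inter_add_rk_union_le (insert e (G ∪ W)) (G ∪ W')
        have h5 : M.rk (insert e G) ≤ M.rk (insert e (G ∪ W) ∩ (G ∪ W')) := by
          refine rk_mono (Set.insert_subset ⟨Or.inl rfl, Or.inr heW'⟩ fun x hx => ?_)
          exact ⟨Or.inr (Or.inl hx), Or.inl hx⟩
        have h6 : M.rk M.E ≤ M.rk (insert e (G ∪ W) ∪ (G ∪ W')) := by
          rw [← hunion]
          refine rk_mono (Set.union_subset ?_ ?_)
          · exact (Set.subset_insert _ _).trans Set.subset_union_left
          · exact Set.subset_union_right.trans Set.subset_union_right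
        have h7 := hGf.rk_lt_of_ssubset (Set.ssubset_insert fun h => he.2 (Or.inl h))
          (Set.insert_subset he.1 hGsub)
        omega
      · refine hW1 (hW.antisymm fun x hx => ?_)
        exact (h.ge hx.1).resolve_left hx.2
    have := hmax hmemW Set.subset_union_left
    obtain ⟨x, hx⟩ := hW0
    exact (hW hx).2 (this (Or.inr hx))
  have hGstressed : M.IsStressed G := by
    have hCfin := M.set_finite G hGsub
    have hc := hC.rk_add_one_eq
    obtain ⟨x, hx⟩ := hC.nonempty
    refine hsplit G ⟨hGf, (restrict_isConnected_iff hGsub).2 hGc, hGcon, ?_, ?_, ?_⟩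
    · have h1 : M.rk {x} ≤ M.rk G := rk_mono (by simpa using hCG (hCcl hx))
      rw [hloop x (hC.subset_ground hx)] at h1
      omega
    · refine lt_of_le_of_ne (rk_le_ncard hCfin) fun h => ?_
      exact hC.not_indep (((indep_iff_rk_eq_ncard hCfin).2 h).subset (hCcl.trans hCG))
    · obtain ⟨e, he⟩ := Set.exists_of_ssubset (hGsub.ssubset_of_ne hGE)
      exact ⟨e, he, hconn.not_isColoop hE⟩
  -- In the uniform restriction to `G` the dependent set `C` has full rank, so its closure is
  -- already `G`.
  have hGC : G = M.closure C := by
    by_contra hne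
    have h1 := (M.isFlat_closure C).rk_lt_of_ssubset (hCG.ssubset_of_ne (Ne.symm hne)) hGsub
    have h2 := (isStressed_iff_rk.1 hGstressed).2.1 C (hCcl.trans hCG)
    have h3 := hC.rk_add_one_eq
    rw [rk_closure_eq] at h1
    omega
  exact hGC ▸ hGstressed

lemma IsConnectedSplit.exists_isRaisedBy (hM : M.IsConnectedSplit) (hA : A ⊆ M.E)
    (h : M.rk A < min A.ncard (M.rk M.E)) : ∃ F, M.IsStressed F ∧ M.IsRaisedBy F A := by
  have hAfin := M.set_finite A hA
  have hdep : M.Dep A := by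
    rw [← not_indep_iff, indep_iff_rk_eq_ncard hAfin]
    omega
  obtain ⟨C, hCA, hC⟩ := hdep.exists_isCircuit_subset
  have hCrk : M.rk C ≤ M.rk A := rk_mono hCA
  -- On at most one element the strict inequality forces A = E, where it fails.
  have hE : M.E.Nontrivial := by
    have := M.ground_finite.to_subtype
    rw [← Set.one_lt_ncard_iff_nontrivial]
    by_contra hle
    have h1 : A = M.E := Set.eq_of_subset_of_ncard_le hA (by omega) M.ground_finite
    rw [h1] at h
    omega
  have hF := hM.isStressed_closure hE hC (by omega)
  have hCcl := M.subset_closure C hC.subset_ground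
  have hCrk1 := hC.rk_add_one_eq
  have hinter : C.ncard ≤ (A ∩ M.closure C).ncard :=
    Set.ncard_le_ncard (Set.subset_inter hCA hCcl) (hAfin.inter_of_left _)
  have hlt : M.rk (M.closure C) < (A ∩ M.closure C).ncard := by
    rw [rk_closure_eq]
    omega
  refine ⟨_, hF, hlt, ?_⟩
  have := hF.rk_eq_of_rk_le_ncard_inter hA hlt.le
  omega

/-- Both ground sets are stressed. A set of deficient rank exceeds the rank of one summand and falls
short of the rank of the other; the exceeded side raises it. -/
lemma disjointSum_exists_isRaisedBy {M₁ M₂ : Matroid α} [M₁.Finite] [M₂.Finite]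
    (hd : Disjoint M₁.E M₂.E) (h₁ : M₁.IsUniform) (h₂ : M₂.IsUniform)
    (hA : A ⊆ (M₁.disjointSum M₂ hd).E)
    (h : (M₁.disjointSum M₂ hd).rk A < min A.ncard
      ((M₁.disjointSum M₂ hd).rk (M₁.disjointSum M₂ hd).E)) :
    ∃ F, (M₁.disjointSum M₂ hd).IsStressed F ∧ (M₁.disjointSum M₂ hd).IsRaisedBy F A := by
  set N := M₁.disjointSum M₂ hd with hN
  have hNE : N.E = M₁.E ∪ M₂.E := disjointSum_ground_eq
  have : N.Finite := ⟨hNE ▸ M₁.ground_finite.union M₂.ground_finite⟩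
  have hrk : ∀ X ⊆ N.E, N.rk X =
      min (X ∩ M₁.E).ncard (M₁.rk M₁.E) + min (X ∩ M₂.E).ncard (M₂.rk M₂.E) := by
    intro X hX
    rw [← h₁.rk_eq Set.inter_subset_right, ← h₂.rk_eq Set.inter_subset_right]
    have h1 := disjointSum_eRk hd (X := X) (hNE ▸ hX)
    rw [← cast_rk (M := M₁), ← cast_rk (M := M₂), ← hN, ← cast_rk] at h1
    exact_mod_cast h1
  have hle₁ : M₁.rk M₁.E ≤ M₁.E.ncard := rk_le_ncard M₁.ground_finite
  have hle₂ : M₂.rk M₂.E ≤ M₂.E.ncard := rk_le_ncard M₂.ground_finite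
  have hi : M₁.E ∩ M₂.E = ∅ := hd.inter_eq
  have hi' : M₂.E ∩ M₁.E = ∅ := hd.symm.inter_eq
  have hsub₁ : M₁.E ⊆ N.E := hNE ▸ Set.subset_union_left
  have hsub₂ : M₂.E ⊆ N.E := hNE ▸ Set.subset_union_right
  have hrE : N.rk N.E = M₁.rk M₁.E + M₂.rk M₂.E := by
    rw [hrk _ subset_rfl, hNE, Set.union_inter_cancel_left, Set.union_inter_cancel_right]
    omega
  have hr₁ : N.rk M₁.E = M₁.rk M₁.E := by
    rw [hrk _ hsub₁, Set.inter_self, hi, Set.ncard_empty]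
    omega
  have hr₂ : N.rk M₂.E = M₂.rk M₂.E := by
    rw [hrk _ hsub₂, Set.inter_self, hi', Set.ncard_empty]
    omega
  have hd₁ : N.E \ M₁.E = M₂.E := by rw [hNE, Set.union_sdiff_left, hd.symm.sdiff_eq_left]
  have hd₂ : N.E \ M₂.E = M₁.E := by rw [hNE, Set.union_sdiff_right, hd.sdiff_eq_left]
  have hs₁ : N.IsStressed M₁.E := by
    refine isStressed_iff_rk.2 ⟨hsub₁, fun X hX => ?_, fun X hX => ?_⟩
    · rw [hrk X (hX.trans hsub₁), hr₁, Set.inter_eq_left.2 hX, (hd.mono_left hX).inter_eq,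
        Set.ncard_empty]
      omega
    · rw [hd₁] at hX
      rw [hrk _ (Set.union_subset (hX.trans hsub₂) hsub₁), hr₁, hrE, Set.union_inter_cancel_right,
        Set.union_inter_distrib_right, hi, Set.union_empty, Set.inter_eq_left.2 hX]
      omega
  have hs₂ : N.IsStressed M₂.E := by
    refine isStressed_iff_rk.2 ⟨hsub₂, fun X hX => ?_, fun X hX => ?_⟩
    · rw [hrk X (hX.trans hsub₂), hr₂, Set.inter_eq_left.2 hX, (hd.symm.mono_left hX).inter_eq,
        Set.ncard_empty]
      omega
    · rw [hd₂] at hX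
      rw [hrk _ (Set.union_subset (hX.trans hsub₁) hsub₂), hr₂, hrE, Set.union_inter_cancel_right,
        Set.union_inter_distrib_right, hi', Set.union_empty, Set.inter_eq_left.2 hX]
      omega
  have hA₁ : A \ M₁.E = A ∩ M₂.E := by
    rw [← hd₁, ← Set.inter_sdiff_assoc, Set.inter_eq_left.2 hA]
  have hA₂ : A \ M₂.E = A ∩ M₁.E := by
    rw [← hd₂, ← Set.inter_sdiff_assoc, Set.inter_eq_left.2 hA]
  have hAn := ncard_inter_add_ncard_sdiff hA M₁.E
  rw [hA₁] at hAn
  rw [hrk A hA, hrE] at h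
  by_cases hc : M₁.rk M₁.E < (A ∩ M₁.E).ncard
  · exact ⟨M₁.E, hs₁, by rwa [hr₁], by rw [hA₁, hrE, hr₁]; omega⟩
  · exact ⟨M₂.E, hs₂, by rw [hr₂]; omega, by rw [hA₂, hrE, hr₂]; omega⟩

lemma IsElementarySplit.exists_isRaisedBy (hM : M.IsElementarySplit) (hA : A ⊆ M.E)
    (h : M.rk A < min A.ncard (M.rk M.E)) : ∃ F, M.IsStressed F ∧ M.IsRaisedBy F A := by
  rcases hM with hM | ⟨M₁, M₂, hd, h₁, h₂, rfl⟩
  · exact hM.exists_isRaisedBy hA h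
  · have hfin := (M₁.disjointSum M₂ hd).ground_finite
    rw [disjointSum_ground_eq] at hfin
    have : M₁.Finite := ⟨hfin.subset Set.subset_union_left⟩
    have : M₂.Finite := ⟨hfin.subset Set.subset_union_right⟩
    exact disjointSum_exists_isRaisedBy hd h₁ h₂ hA h

end Connected

end Matroid
-- Counting subsets by the sizes of their two parts.
lemma Finset.sum_powerset_card_inter_card_sdiff {α R : Type*} [DecidableEq α] [CommSemiring R]
    {s u : Finset α} (hs : s ⊆ u) (g : ℕ → ℕ → R) :
    ∑ A ∈ u.powerset, g (A ∩ s).card (A \ s).card =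
      ∑ i ∈ Finset.range (s.card + 1), ∑ j ∈ Finset.range ((u \ s).card + 1),
        ((s.card.choose i * (u \ s).card.choose j : ℕ) : R) * g i j := by
  have h1 : ∑ A ∈ u.powerset, g (A ∩ s).card (A \ s).card =
      ∑ p ∈ s.powerset ×ˢ (u \ s).powerset, g p.1.card p.2.card := by
    refine Finset.sum_nbij' (fun A => (A ∩ s, A \ s)) (fun p => p.1 ∪ p.2) ?_ ?_ ?_ ?_ ?_
    · intro A hA
      rw [Finset.mem_powerset] at hA
      simp only [Finset.mem_product, Finset.mem_powerset]
      exact ⟨Finset.inter_subset_right, Finset.sdiff_subset_sdiff hA subset_rfl⟩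
    · rintro ⟨X, Y⟩ h
      simp only [Finset.mem_product, Finset.mem_powerset] at h ⊢
      exact Finset.union_subset (h.1.trans hs) (h.2.trans Finset.sdiff_subset)
    · intro A _
      ext x
      simp only [Finset.mem_union, Finset.mem_inter, Finset.mem_sdiff]
      tauto
    · rintro ⟨X, Y⟩ h
      simp only [Finset.mem_product, Finset.mem_powerset] at h
      have hX : ∀ x ∈ X, x ∈ s := fun x hx => h.1 hx
      have hY : ∀ x ∈ Y, x ∉ s := fun x hx => (Finset.mem_sdiff.1 (h.2 hx)).2
      ext x
      · simp only [Finset.mem_inter, Finset.mem_union]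
        exact ⟨fun hx => hx.1.resolve_right fun h' => hY x h' hx.2, fun hx => ⟨Or.inl hx, hX x hx⟩⟩
      · simp only [Finset.mem_sdiff, Finset.mem_union]
        exact ⟨fun hx => hx.1.resolve_left fun h' => hx.2 (hX x h'), fun hx => ⟨Or.inr hx, hY x hx⟩⟩
    · intro A _
      rfl
  rw [h1, Finset.sum_product]
  simp_rw [Finset.sum_powerset_apply_card]
  rw [Finset.sum_powerset_apply_card
    (fun i => ∑ j ∈ Finset.range ((u \ s).card + 1), (u \ s).card.choose j • g i j)]
  simp_rw [Finset.smul_sum, nsmul_eq_mul, Nat.cast_mul, mul_assoc]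

/-! ### Single terms of the Tutte polynomial. -/

namespace Matroid

open MvPolynomial

/-- The summand of the Tutte polynomial of a matroid of rank `k` that belongs to a set of rank `s`
and cardinality `c`. -/
noncomputable def tutteTerm (k s c : ℕ) : MvPolynomial (Fin 2) ℤ :=
  (X 0 - 1) ^ (k - s) * (X 1 - 1) ^ (c - s)

/-- The old term is the new one times a power of (x-1)(y-1), with exponent the increase in rank: i -
r or k - r - j. -/
lemma tutteTerm_add_tutteAlpha {r k i j : ℕ} (hi : r < i) (hj : j < k - r) :
    tutteTerm k (r + j) (i + j) + tutteAlpha r k i j = tutteTerm k (min (i + j) k) (i + j) := by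
  unfold tutteTerm tutteAlpha
  split_ifs with h
  · have h1 : k - (r + j) = (k - i - j) + (i - r) := by omega
    have h2 : i + j - (r + j) = i - r := by omega
    rw [min_eq_left h, h1, h2, Nat.sub_self, Nat.sub_sub, pow_add, mul_pow]
    ring
  · have h1 : i + j - (r + j) = (i + j - k) + (k - r - j) := by omega
    rw [min_eq_right (not_le.1 h).le, h1, Nat.sub_self, Nat.sub_sub, pow_add, mul_pow]
    ring

lemma dvd_tutteAlpha (r k i j : ℕ) :
    (X 0 + X 1 - X 0 * X 1 : MvPolynomial (Fin 2) ℤ) ∣ tutteAlpha r k i j := by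
  have h : ∀ m : ℕ, (X 0 + X 1 - X 0 * X 1 : MvPolynomial (Fin 2) ℤ) ∣
      1 - ((X 0 - 1) * (X 1 - 1)) ^ m := fun m => by
    have h1 := sub_dvd_pow_sub_pow (1 : MvPolynomial (Fin 2) ℤ) ((X 0 - 1) * (X 1 - 1)) m
    rw [one_pow] at h1
    convert! h1 using 1
    ring
  unfold tutteAlpha
  split_ifs
  · exact (h _).mul_left _
  · exact (h _).mul_left _

lemma tutte_uniform {k n : ℕ} (hkn : k ≤ n) :
    (uniform k n).tutte =
      ∑ m ∈ Finset.range (n + 1), n.choose m • tutteTerm k (min m k) m := by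
  have hE : (uniform k n).E = Set.univ := rfl
  have hfin : (uniform k n).ground_finite.toFinset = Finset.univ := by
    ext; simp [hE]
  have hcard := Finset.sum_powerset_apply_card (fun m => tutteTerm k (min m k) m)
    (x := (Finset.univ : Finset (Fin n)))
  rw [Finset.card_univ, Fintype.card_fin] at hcard
  rw [tutte, hfin, ← hcard]
  refine Finset.sum_congr rfl fun A _ => ?_
  rw [uniform_rk, uniform_rk, hE, Set.ncard_univ, Nat.card_eq_fintype_card, Fintype.card_fin,
    Set.ncard_coe_finset, min_eq_left hkn, min_eq_right hkn]
  rfl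

/-! ### Summing the changes over all subsets. -/

section Sums

variable {α : Type*} {M : Matroid α} [M.Finite] {F A : Set α}

lemma coe_subset_ground {A : Finset α} (hA : A ∈ M.ground_finite.toFinset.powerset) :
    (A : Set α) ⊆ M.E := by
  rw [Finset.mem_powerset] at hA
  intro x hx
  simpa using hA hx

open scoped Classical in
lemma sum_isRaisedBy {R : Type*} [CommSemiring R] (hF : F ⊆ M.E) (f : ℕ → ℕ → R) :
    (∑ A ∈ M.ground_finite.toFinset.powerset,
      if M.IsRaisedBy F (A : Set α) then f ((A : Set α) ∩ F).ncard ((A : Set α) \ F).ncard else 0) =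
    ∑ i ∈ Finset.Icc (M.rk F + 1) F.ncard, ∑ j ∈ Finset.range (M.rk M.E - M.rk F),
      ((F.ncard.choose i * (M.E.ncard - F.ncard).choose j : ℕ) : R) * f i j := by
  have hFfin := M.set_finite F hF
  set u := M.ground_finite.toFinset with hu
  set s := hFfin.toFinset with hs
  have hsu : s ⊆ u := Set.Finite.toFinset_subset_toFinset.2 hF
  have hsc : s.card = F.ncard := (Set.ncard_eq_toFinset_card F hFfin).symm
  have huc : u.card = M.E.ncard := (Set.ncard_eq_toFinset_card M.E M.ground_finite).symm
  have husc : (u \ s).card = M.E.ncard - F.ncard := by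
    rw [Finset.card_sdiff_of_subset hsu, huc, hsc]
  have hA1 : ∀ A : Finset α, ((A : Set α) ∩ F).ncard = (A ∩ s).card := fun A => by
    rw [← Set.ncard_coe_finset, Finset.coe_inter, hs, Set.Finite.coe_toFinset]
  have hA2 : ∀ A : Finset α, ((A : Set α) \ F).ncard = (A \ s).card := fun A => by
    rw [← Set.ncard_coe_finset, Finset.coe_sdiff, hs, Set.Finite.coe_toFinset]
  -- Guarantees that the range j < k - r lies within the possible sizes of A \ F.
  have hrk : M.rk M.E - M.rk F ≤ M.E.ncard - F.ncard := by
    have h1 := M.rk_union_le F (M.E \ F)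
    have h2 := M.rk_le_ncard (M.ground_finite.sdiff (t := F))
    rw [Set.union_sdiff_cancel hF] at h1
    rw [Set.ncard_sdiff hF hFfin] at h2
    omega
  have hsum := Finset.sum_powerset_card_inter_card_sdiff hsu
    (fun i j => if M.rk F < i ∧ j < M.rk M.E - M.rk F then f i j else 0)
  simp only [IsRaisedBy, hA1, hA2]
  rw [hsum, hsc, husc]
  have hI : Finset.Icc (M.rk F + 1) F.ncard =
      (Finset.range (F.ncard + 1)).filter (M.rk F < ·) := by
    ext i; simp; omega
  have hJ : Finset.range (M.rk M.E - M.rk F) =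
      (Finset.range (M.E.ncard - F.ncard + 1)).filter (· < M.rk M.E - M.rk F) := by
    ext j; simp; omega
  rw [hI, Finset.sum_filter]
  refine Finset.sum_congr rfl fun i _ => ?_
  split_ifs with hi
  · rw [hJ, Finset.sum_filter]
    refine Finset.sum_congr rfl fun j _ => ?_
    simp [hi]
  · simp [hi]

lemma IsStressed.tutteTerm_of_isRaisedBy (hF : M.IsStressed F) (hA : A ⊆ M.E)
    (h : M.IsRaisedBy F A) :
    tutteTerm (M.rk M.E) (min A.ncard (M.rk M.E)) A.ncard =
      tutteTerm (M.rk M.E) (M.rk A) A.ncard +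
        tutteAlpha (M.rk F) (M.rk M.E) (A ∩ F).ncard (A \ F).ncard := by
  rw [hF.rk_eq_of_isRaisedBy hA h, ← ncard_inter_add_ncard_sdiff hA F,
    tutteTerm_add_tutteAlpha h.1 h.2]

lemma relax_tutte (hF : M.IsStressed F) :
    (M.relax F hF).tutte = M.tutte +
      ∑ i ∈ Finset.Icc (M.rk F + 1) F.ncard, ∑ j ∈ Finset.range (M.rk M.E - M.rk F),
        ((F.ncard.choose i * (M.E.ncard - F.ncard).choose j : ℕ) : MvPolynomial (Fin 2) ℤ) *
          tutteAlpha (M.rk F) (M.rk M.E) i j := by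
  classical
  rw [← sum_isRaisedBy hF.1 (tutteAlpha (M.rk F) (M.rk M.E)), tutte, tutte,
    ← Finset.sum_add_distrib]
  refine Finset.sum_congr rfl fun A hA => ?_
  have hAE : (A : Set α) ⊆ M.E := coe_subset_ground hA
  rw [relax_ground, relax_rk_ground, ← Set.ncard_coe_finset]
  split_ifs with h
  · rw [relax_rk_of_isRaisedBy hF hAE h]
    exact hF.tutteTerm_of_isRaisedBy hAE h
  · rw [relax_rk_of_not_isRaisedBy hF hAE h, add_zero]

open scoped Classical in
-- A set of deficient rank contributes exactly one summand, by existence and uniqueness of the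
-- raising set; any other set is raised by nothing.
lemma IsElementarySplit.tutteTerm_eq (hM : M.IsElementarySplit) {S : Finset (Set α)}
    (hS : ∀ F, F ∈ S ↔ M.IsStressed F ∧ (M.cusp F).Nonempty) (hA : A ⊆ M.E) :
    tutteTerm (M.rk M.E) (min A.ncard (M.rk M.E)) A.ncard =
      tutteTerm (M.rk M.E) (M.rk A) A.ncard + ∑ F ∈ S, if M.IsRaisedBy F A then
        tutteAlpha (M.rk F) (M.rk M.E) (A ∩ F).ncard (A \ F).ncard else 0 := by
  by_cases hlt : M.rk A < min A.ncard (M.rk M.E)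
  · obtain ⟨F, hF, hFA⟩ := hM.exists_isRaisedBy hA hlt
    rw [Finset.sum_eq_single F, if_pos hFA, hF.tutteTerm_of_isRaisedBy hA hFA]
    · intro G hG hGF
      exact if_neg fun h => hGF (((hS G).1 hG).1.eq_of_isRaisedBy hF hA h hFA)
    · exact fun h => absurd ((hS F).2 ⟨hF, hFA.cusp_nonempty hA⟩) h
  · have h1 : M.rk A = min A.ncard (M.rk M.E) :=
      le_antisymm (le_min (rk_le_ncard (M.set_finite A hA)) (rk_mono hA)) (not_lt.1 hlt)
    rw [Finset.sum_eq_zero, add_zero, ← h1]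
    intro F hF
    exact if_neg fun h => hlt (((hS F).1 hF).1.rk_lt_of_isRaisedBy hA h)

lemma sum_stressed_eq_sum_numStressed {S : Finset (Set α)}
    (hS : ∀ F, F ∈ S ↔ M.IsStressed F ∧ (M.cusp F).Nonempty) {R : Type*} [CommSemiring R]
    (f : ℕ → ℕ → R) :
    ∑ F ∈ S, f (M.rk F) F.ncard = ∑ r ∈ Finset.range (M.rk M.E + 1),
      ∑ h ∈ Finset.range (M.E.ncard + 1), (M.numStressed r h : R) * f r h := by
  have hmaps : ∀ F ∈ S, (M.rk F, F.ncard) ∈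
      Finset.range (M.rk M.E + 1) ×ˢ Finset.range (M.E.ncard + 1) := by
    intro F hF
    have hFE := ((hS F).1 hF).1.1
    have h1 : M.rk F ≤ M.rk M.E := rk_mono hFE
    have h2 := Set.ncard_le_ncard hFE M.ground_finite
    simp only [Finset.mem_product, Finset.mem_range]
    omega
  rw [← Finset.sum_fiberwise_of_maps_to hmaps, Finset.sum_product]
  refine Finset.sum_congr rfl fun r _ => Finset.sum_congr rfl fun h _ => ?_
  have hcard : M.numStressed r h = (S.filter fun F => (M.rk F, F.ncard) = (r, h)).card := by
    rw [numStressed, ← Set.ncard_coe_finset]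
    congr 1
    ext F
    simp [hS, and_assoc]
  rw [hcard, ← nsmul_eq_mul, ← Finset.sum_const]
  refine Finset.sum_congr rfl fun F hF => ?_
  obtain ⟨h1, h2⟩ := Prod.mk.inj (Finset.mem_filter.1 hF).2
  rw [h1, h2]

lemma IsElementarySplit.tutte_eq (hM : M.IsElementarySplit) :
    M.tutte = (uniform (M.rk M.E) M.E.ncard).tutte -
      ∑ r ∈ Finset.range (M.rk M.E + 1), ∑ h ∈ Finset.range (M.E.ncard + 1),
        (M.numStressed r h : MvPolynomial (Fin 2) ℤ) *
          ∑ i ∈ Finset.Icc (r + 1) h, ∑ j ∈ Finset.range (M.rk M.E - r),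
            ((h.choose i * (M.E.ncard - h).choose j : ℕ) : MvPolynomial (Fin 2) ℤ) *
              tutteAlpha r (M.rk M.E) i j := by
  classical
  have hfin : {F | M.IsStressed F ∧ (M.cusp F).Nonempty}.Finite :=
    M.ground_finite.powerset.subset fun F hF => hF.1.1
  have hS : ∀ F, F ∈ hfin.toFinset ↔ M.IsStressed F ∧ (M.cusp F).Nonempty := by simp
  rw [← sum_stressed_eq_sum_numStressed hS fun r h =>
    ∑ i ∈ Finset.Icc (r + 1) h, ∑ j ∈ Finset.range (M.rk M.E - r),
      ((h.choose i * (M.E.ncard - h).choose j : ℕ) : MvPolynomial (Fin 2) ℤ) *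
        tutteAlpha r (M.rk M.E) i j]
  -- Each binomial sum is turned back into a sum over the sets raised by `F`; swapping the two
  -- summations leaves an identity for each `A`.
  rw [Finset.sum_congr rfl fun F hF =>
      (sum_isRaisedBy ((hS F).1 hF).1.1 (tutteAlpha (M.rk F) (M.rk M.E))).symm,
    Finset.sum_comm, eq_sub_iff_add_eq, tutte, ← Finset.sum_add_distrib,
    tutte_uniform (rk_le_ncard M.ground_finite), Set.ncard_eq_toFinset_card M.E M.ground_finite,
    ← Finset.sum_powerset_apply_card (fun m => tutteTerm (M.rk M.E) (min m (M.rk M.E)) m)]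
  refine Finset.sum_congr rfl fun A hA => ?_
  have h := hM.tutteTerm_eq hS (coe_subset_ground hA)
  rw [Set.ncard_coe_finset] at h
  exact h.symm

end Sums

end Matroid

/-- The change of the Tutte polynomial under relaxation of a stressed subset with non-empty cusp,
and the resulting formula for the Tutte polynomial of an elementary split matroid. In the last sum
`r` and `h` run over all values for which `λ_{r,h}` can be non-zero. -/
theorem theorem6p3 {α : Type*} (M : Matroid α) [M.Finite] (k n : ℕ)
    (hk : M.rk M.E = k) (hn : M.E.ncard = n) :
    (∀ (F : Set α) (hF : M.IsStressed F) (r h : ℕ), (M.cusp F).Nonempty →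
        M.rk F = r → F.ncard = h →
        (M.relax F hF).tutte = M.tutte +
            ∑ i ∈ Finset.Icc (r + 1) h, ∑ j ∈ Finset.range (k - r),
              ((h.choose i * (n - h).choose j : ℕ) : MvPolynomial (Fin 2) ℤ) *
                Matroid.tutteAlpha r k i j ∧
        (MvPolynomial.X 0 + MvPolynomial.X 1 - MvPolynomial.X 0 * MvPolynomial.X 1 :
            MvPolynomial (Fin 2) ℤ) ∣ (M.relax F hF).tutte - M.tutte) ∧
    (M.IsElementarySplit →
        M.tutte = (Matroid.uniform k n).tutte -
          ∑ r ∈ Finset.range (k + 1), ∑ h ∈ Finset.range (n + 1),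
            (M.numStressed r h : MvPolynomial (Fin 2) ℤ) *
              ∑ i ∈ Finset.Icc (r + 1) h, ∑ j ∈ Finset.range (k - r),
                ((h.choose i * (n - h).choose j : ℕ) : MvPolynomial (Fin 2) ℤ) *
                  Matroid.tutteAlpha r k i j) := by
  subst hk hn
  refine ⟨?_, fun hM => hM.tutte_eq⟩
  rintro F hF r h - rfl rfl
  have heq := Matroid.relax_tutte hF
  refine ⟨heq, ?_⟩
  rw [heq, add_sub_cancel_left]
  exact Finset.dvd_sum fun i _ => Finset.dvd_sum fun j _ =>
    (Matroid.dvd_tutteAlpha _ _ i j).mul_left _
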